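/- Let $n\ge 2$ and let $\Omega\subset\mathbb R^n$ be either a bounded Lipschitz domain or an exterior Lipschitz domain, i.e. $\Omega=\mathbb R^n\setminus\overline{\Omega_0}$ with $\Omega_0$ a bounded Lipschitz domain. For $s\ge 0$ let $H^s(\Omega)$ be the $L^2$-based (complex) Sobolev space of order $s$, i.e. the space of restrictions to $\Omega$ of elements of $H^s(\mathbb R^n)$ with norm $\|f\|_{H^s(\Omega)}=\inf\{\|F\|_{H^s(\mathbb R^n)}: F|_\Omega=f\}$, and let $H^s_\Delta(\Omega)=\{f\in H^s(\Omega):\Delta f\in L^2(\Omega)\}$, with $\Delta f$ taken in the sense of distributions on $\Omega$. (1) Let $s>0$ and let $W\in L^p(\Omega)$ be complex-valued, where $p\ge n/s$ if $n>2s$ and $p>2$ if $n\le 2s$ ($p=\infty$ is allowed). Then $Wf,\overline{W}f\in L^2(\Omega)$ for all $f\in H^s(\Omega)$, and for every $\varepsilon>0$ there exists $C_\varepsilon>0$ such that $$\|Wf\|_{L^2(\Omega)}=\|\overline{W}f\|_{L^2(\Omega)}\le \varepsilon\|f\|_{H^s(\Omega)}+C_\varepsilon\|f\|_{L^2(\Omega)},\qquad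 f\in H^s(\Omega).$$ (2) In particular, if $V\in L^p(\Omega)$ is complex-valued, where $p\ge 2n/3$ if $n>3$ and $p>2$ if $n\in\{2,3\}$ ($p=\infty$ is allowed), then the statements in (1) hold for $s=3/2$ and $W=V$; moreover, $$H^{3/2}_\Delta(\Omega)=\{f\in H^{3/2}(\Omega):-\Delta f+Vf\in L^2(\Omega)\}=\{f\in H^{3/2}(\Omega):-\Delta f+\overline{V}f\in L^2(\Omega)\},$$ where $-\Delta f+Vf$ and $-\Delta f+\overline{V}f$ are understood as distributions on $\Omega$. -/

import Mathlib

open MeasureTheory TopologicalSpace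
open scoped ENNReal NNReal ComplexConjugate Distributions SchwartzMap LineDeriv RealInnerProductSpace

noncomputable section

namespace SobolevMult

/-- Euclidean space of dimension `n`. -/
abbrev Euc (n : ℕ) : Type := EuclideanSpace ℝ (Fin n)

/-- The complex space `L²(Ω)`, with respect to Lebesgue measure on `Ω`. -/
abbrev L2 {n : ℕ} (Ω : Opens (Euc n)) : Type :=
  Lp ℂ 2 ((volume : Measure (Euc n)).restrict (Ω : Set (Euc n)))

/-! ### Lipschitz domains -/

/-- A bounded Lipschitz domain: a bounded open set which, near each of its boundary points,
coincides with the strict hypograph of a Lipschitz function in suitable Cartesian coordinates.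
Here `ν` is the unit vector in the vertical direction, and the graph function `φ` is defined on
the hyperplane orthogonal to `ν`. The boundary is compact, so that finitely many of the
neighbourhoods `U` cover it. Connectedness is not required. -/
def IsBoundedLipschitz {n : ℕ} (Ω : Opens (Euc n)) : Prop :=
  Bornology.IsBounded (Ω : Set (Euc n)) ∧
  ∀ x ∈ frontier (Ω : Set (Euc n)),
    ∃ U : Opens (Euc n), x ∈ U ∧
    ∃ (ν : Euc n) (φ : (ℝ ∙ ν)ᗮ → ℝ) (K : ℝ≥0), ‖ν‖ = 1 ∧ LipschitzWith K φ ∧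
      ∀ y ∈ U, y ∈ Ω ↔ ⟪ν, y⟫ < φ ((ℝ ∙ ν)ᗮ.orthogonalProjectionOnto y)

/-- An exterior Lipschitz domain: the complement of the closure of a bounded Lipschitz domain. -/
def IsExteriorLipschitz {n : ℕ} (Ω : Opens (Euc n)) : Prop :=
  ∃ Ω₀ : Opens (Euc n), IsBoundedLipschitz Ω₀ ∧
    (Ω : Set (Euc n)) = (closure (Ω₀ : Set (Euc n)))ᶜ

/-! ### Sobolev spaces -/

/-- `F ∈ L²(ℝⁿ)` belongs to `H^s(ℝⁿ)`, with Bessel potential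
`𝓕⁻¹ ((1 + |ξ|²)^{s/2} 𝓕 F) = G ∈ L²(ℝⁿ)`. The norm of `F` in `H^s(ℝⁿ)` is then `‖G‖_{L²}`. -/
def HasBessel {n : ℕ} (s : ℝ) (F G : Lp ℂ 2 (volume : Measure (Euc n))) : Prop :=
  TemperedDistribution.besselPotential (Euc n) ℂ s (F : 𝓢'(Euc n, ℂ)) = (G : 𝓢'(Euc n, ℂ))

/-- `F`, defined on `ℝⁿ`, restricts to `f` on `Ω`. -/
def Restricts {n : ℕ} {Ω : Opens (Euc n)} (F : Lp ℂ 2 (volume : Measure (Euc n)))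
    (f : L2 Ω) : Prop :=
  F =ᵐ[(volume : Measure (Euc n)).restrict (Ω : Set (Euc n))] f

/-- The Sobolev space `H^s(Ω)`, `s ≥ 0`: the restrictions to `Ω` of the elements of
`H^s(ℝⁿ)`. -/
def Hs {n : ℕ} (s : ℝ) (Ω : Opens (Euc n)) : Set (L2 Ω) :=
  {f | ∃ F : Lp ℂ 2 (volume : Measure (Euc n)),
    TemperedDistribution.MemSobolev s 2 (F : 𝓢'(Euc n, ℂ)) ∧ Restricts F f}

/-- The norm of `H^s(Ω)`: the infimum of the `H^s(ℝⁿ)`-norms of all extensions. It is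
meaningful for `f ∈ Hs s Ω`. -/
def hsNorm {n : ℕ} (s : ℝ) {Ω : Opens (Euc n)} (f : L2 Ω) : ℝ :=
  sInf {r : ℝ | ∃ F G : Lp ℂ 2 (volume : Measure (Euc n)),
    HasBessel s F G ∧ Restricts F f ∧ r = ‖G‖}

/-! ### Distributions on `Ω` -/

/-- The regular distribution `φ ↦ ∫_Ω φ u` on `Ω` of a locally integrable function `u`. -/
def toDistr {n : ℕ} (Ω : Opens (Euc n)) (u : Euc n → ℂ) : 𝓓'(Ω, ℂ) :=
  ContinuousLinearMap.toUniformConvergenceCLM _ _ _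
    (TestFunction.integralAgainstBilinCLM (ContinuousLinearMap.lsmul ℝ ℝ : ℝ →L[ℝ] ℂ →L[ℝ] ℂ)
      ((volume : Measure (Euc n)).restrict (Ω : Set (Euc n))) u)

/-- The Laplacian of a distribution on `Ω`. -/
def laplace {n : ℕ} {Ω : Opens (Euc n)} (T : 𝓓'(Ω, ℂ)) : 𝓓'(Ω, ℂ) :=
  ∑ i : Fin n, ∂_{EuclideanSpace.single i (1 : ℝ)} (∂_{EuclideanSpace.single i (1 : ℝ)} T)

/-- The distribution `T` on `Ω` belongs to `L²(Ω)`. -/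
def InL2 {n : ℕ} {Ω : Opens (Euc n)} (T : 𝓓'(Ω, ℂ)) : Prop :=
  ∃ g : L2 Ω, T = toDistr Ω g

/-- The space `H^s_Δ(Ω) = {f ∈ H^s(Ω) : Δ f ∈ L²(Ω)}`. -/
def HsLaplace {n : ℕ} (s : ℝ) (Ω : Opens (Euc n)) : Set (L2 Ω) :=
  {f | f ∈ Hs s Ω ∧ InL2 (laplace (toDistr Ω f))}

/-- The space `{f ∈ H^s(Ω) : -Δ f + V f ∈ L²(Ω)}`, where `-Δ f + V f` is understood in the sense of
distributions on `Ω`. It is used for `V ∈ L^p(Ω)` with `p ≥ 2` only; then `V f` is locally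
integrable for every `f ∈ L²(Ω)`. -/
def HsSchrodinger {n : ℕ} (s : ℝ) (Ω : Opens (Euc n)) (V : Euc n → ℂ) : Set (L2 Ω) :=
  {f | f ∈ Hs s Ω ∧ InL2 (-laplace (toDistr Ω f) + toDistr Ω (fun x ↦ V x * f x))}

/-- Multiplication by `W` and by its complex conjugate maps `H^s(Ω)` into `L²(Ω)`, and for every
`ε > 0` there is `C > 0` with
`‖W f‖_{L²} = ‖conj W f‖_{L²} ≤ ε ‖f‖_{H^s} + C ‖f‖_{L²}` for all `f ∈ H^s(Ω)`. -/
def MulBound {n : ℕ} (s : ℝ) (Ω : Opens (Euc n)) (W : Euc n → ℂ) : Prop :=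
  (∀ f ∈ Hs s Ω,
    MemLp (fun x ↦ W x * f x) 2 ((volume : Measure (Euc n)).restrict (Ω : Set (Euc n))) ∧
    MemLp (fun x ↦ conj (W x) * f x) 2
      ((volume : Measure (Euc n)).restrict (Ω : Set (Euc n)))) ∧
  ∀ ε : ℝ, 0 < ε → ∃ C : ℝ, 0 < C ∧ ∀ f ∈ Hs s Ω,
    (eLpNorm (fun x ↦ W x * f x) 2
      ((volume : Measure (Euc n)).restrict (Ω : Set (Euc n)))).toReal =
    (eLpNorm (fun x ↦ conj (W x) * f x) 2
      ((volume : Measure (Euc n)).restrict (Ω : Set (Euc n)))).toReal ∧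
    (eLpNorm (fun x ↦ W x * f x) 2
      ((volume : Measure (Euc n)).restrict (Ω : Set (Euc n)))).toReal
      ≤ ε * hsNorm s f + C * ‖f‖

end SobolevMult

end

/-!
Multiplication by `W` is estimated through a Sobolev embedding on the whole space, applied to an
arbitrary extension of `f`. The embedding `‖f‖_q ≤ C ‖|ξ|^t 𝓕 f‖_{L²}`, `t = n (1/2 - 1/q)`, is
obtained as in Chemin–Xu: for each level `l` the frequencies of `f` are split at a radius `R(l)` so
chosen that the low-frequency part is at most `l / 2` everywhere, by Cauchy–Schwarz against the
weight `|ξ|^{-t}`. On `{l < |f|}` the high-frequency part then exceeds `l / 2`, Chebyshev and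
Plancherel bound the measure of this set, and the layer-cake formula integrates over `l`.
Writing `W` as the sum of a small element of `L^p` and a bounded function, Hölder's inequality with
`1/p + 1/q = 1/2` gives the bound with `ε`. Since `W f` is then in `L²`, adding it to `-Δ f` does
not affect membership in `L²`.
-/

namespace SobolevMult

open Set Metric Module FourierTransform

section LayerCake

variable {α β : Type*} [MeasurableSpace α] [MeasurableSpace β] {μ : Measure α} {ν : Measure β}

theorem lintegral_rpow_le_of_meas_lt_le {f : α → ℝ} {w : β → ℝ} {q r : ℝ} {C : ℝ≥0}
    (hf : 0 ≤ f) (hfm : AEMeasurable f μ) (hw : 0 ≤ w) (hwm : AEMeasurable w ν)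
    (hq : 0 < q) (hrq : r < q)
    (h : ∀ l > 0, μ {x | l < f x} ≤ C * ENNReal.ofReal (l ^ (-r)) * ν {y | l ≤ w y}) :
    ∫⁻ x, ENNReal.ofReal (f x ^ q) ∂μ ≤
      C * ENNReal.ofReal (q / (q - r)) * ∫⁻ y, ENNReal.ofReal (w y ^ (q - r)) ∂ν := by
  have hqr : 0 < q - r := sub_pos.2 hrq
  calc ∫⁻ x, ENNReal.ofReal (f x ^ q) ∂μ
      = ENNReal.ofReal q * ∫⁻ l in Ioi 0, μ {x | l < f x} * ENNReal.ofReal (l ^ (q - 1)) :=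
        lintegral_rpow_eq_lintegral_meas_lt_mul μ (.of_forall hf) hfm hq
    _ ≤ ENNReal.ofReal q * ∫⁻ l in Ioi 0,
          C * (ν {y | l ≤ w y} * ENNReal.ofReal (l ^ (q - r - 1))) := by
        gcongr ENNReal.ofReal q * ?_
        refine setLIntegral_mono' measurableSet_Ioi fun l (hl : 0 < l) ↦ ?_
        have hpow : l ^ (q - r - 1) = l ^ (-r) * l ^ (q - 1) := by
          rw [← Real.rpow_add hl]
          ring_nf
        calc μ {x | l < f x} * ENNReal.ofReal (l ^ (q - 1))
            ≤ C * ENNReal.ofReal (l ^ (-r)) * ν {y | l ≤ w y} * ENNReal.ofReal (l ^ (q - 1)) := by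
              gcongr
              exact h l hl
          _ = C * (ν {y | l ≤ w y} * ENNReal.ofReal (l ^ (q - r - 1))) := by
              rw [hpow, ENNReal.ofReal_mul (by positivity)]
              ring
    _ = C * ENNReal.ofReal (q / (q - r)) * (ENNReal.ofReal (q - r) *
          ∫⁻ l in Ioi 0, ν {y | l ≤ w y} * ENNReal.ofReal (l ^ (q - r - 1))) := by
        rw [lintegral_const_mul' _ _ ENNReal.coe_ne_top]
        have hqr' : ENNReal.ofReal q = ENNReal.ofReal (q / (q - r)) * ENNReal.ofReal (q - r) := by
          rw [← ENNReal.ofReal_mul (by positivity), div_mul_cancel₀ _ hqr.ne']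
        rw [hqr']
        ring
    _ = C * ENNReal.ofReal (q / (q - r)) * ∫⁻ y, ENNReal.ofReal (w y ^ (q - r)) ∂ν := by
        rw [lintegral_rpow_eq_lintegral_meas_le_mul ν (.of_forall hw) hwm hqr]

end LayerCake

section Ball

variable {E : Type*} [NormedAddCommGroup E] [NormedSpace ℝ E] [FiniteDimensional ℝ E]
  [MeasurableSpace E] [BorelSpace E] (μ : Measure E) [μ.IsAddHaarMeasure]

theorem setIntegral_ball_norm_rpow (a : ℝ) {R : ℝ} (hR : 0 < R) :
    ∫ x in ball (0 : E) R, ‖x‖ ^ a ∂μ =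
      R ^ (finrank ℝ E + a) * ∫ x in ball (0 : E) 1, ‖x‖ ^ a ∂μ := by
  have h := Measure.setIntegral_comp_smul_of_pos μ (fun x : E ↦ ‖x‖ ^ a) (ball 0 1) hR
  simp only [smul_unitBall_of_pos hR, norm_smul, Real.norm_of_nonneg hR.le,
    Real.mul_rpow hR.le (norm_nonneg _), integral_const_mul, smul_eq_mul] at h
  rw [Real.rpow_add hR, Real.rpow_natCast, mul_assoc, h, mul_inv_cancel_left₀ (by positivity)]

variable [Nontrivial E]

theorem integrableOn_ball_norm_rpow {a : ℝ} (ha : -(finrank ℝ E : ℝ) < a) (R : ℝ) :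
    IntegrableOn (fun x : E ↦ ‖x‖ ^ a) (ball 0 R) μ := by
  rw [integrableOn_fun_norm_addHaar μ (f := fun y ↦ y ^ a)]
  have hpow : EqOn (fun y : ℝ ↦ y ^ ((finrank ℝ E : ℝ) - 1 + a))
      (fun y ↦ y ^ (finrank ℝ E - 1) • y ^ a) (Ioo 0 R) := fun y hy ↦ by
    simp only [smul_eq_mul]
    rw [Real.rpow_add hy.1, ← Nat.cast_pred finrank_pos, Real.rpow_natCast]
  refine IntegrableOn.congr_fun ?_ hpow measurableSet_Ioo
  exact (intervalIntegral.intervalIntegrable_rpow' (by linarith)).1.mono_set Ioo_subset_Ioc_self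

theorem eLpNorm_norm_rpow_restrict_ball {a : ℝ} (ha : -(finrank ℝ E : ℝ) < 2 * a) {R : ℝ}
    (hR : 0 < R) :
    eLpNorm (fun x : E ↦ ‖x‖ ^ a) 2 (μ.restrict (ball 0 R)) =
      ENNReal.ofReal (√(∫ x in ball (0 : E) 1, ‖x‖ ^ (2 * a) ∂μ) * R ^ (finrank ℝ E / 2 + a)) := by
  have hsq (x : E) : ‖‖x‖ ^ a‖ₑ ^ (2 : ℝ) = ENNReal.ofReal (‖x‖ ^ (2 * a)) := by
    rw [Real.enorm_of_nonneg (by positivity),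
      ENNReal.ofReal_rpow_of_nonneg (by positivity) two_pos.le, ← Real.rpow_mul (norm_nonneg x),
      mul_comm a]
  have hint : ∫⁻ x in ball (0 : E) R, ENNReal.ofReal (‖x‖ ^ (2 * a)) ∂μ =
      ENNReal.ofReal (R ^ (finrank ℝ E + 2 * a) * ∫ x in ball (0 : E) 1, ‖x‖ ^ (2 * a) ∂μ) := by
    rw [← setIntegral_ball_norm_rpow μ _ hR, ofReal_integral_eq_lintegral_ofReal
      (integrableOn_ball_norm_rpow μ ha R) (.of_forall fun x ↦ by positivity)]
  rw [eLpNorm_eq_lintegral_rpow_enorm_toReal two_ne_zero ENNReal.ofNat_ne_top]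
  simp only [ENNReal.toReal_ofNat, hsq]
  rw [hint, ENNReal.ofReal_rpow_of_nonneg (by positivity) (by positivity), Real.sqrt_eq_rpow,
    Real.mul_rpow (by positivity) (by positivity), ← Real.rpow_mul hR.le, mul_comm]
  ring_nf

variable {F : Type*} [NormedAddCommGroup F] [NormedSpace ℝ F]

theorem lintegral_ball_enorm_le {t : ℝ} (ht : 2 * t < finrank ℝ E) :
    ∃ K > 0, ∀ u : E → F, AEStronglyMeasurable u μ → ∀ R > 0,
      ∫⁻ x in ball 0 R, ‖u x‖ₑ ∂μ ≤
        ENNReal.ofReal (K * R ^ (finrank ℝ E / 2 - t)) *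
          eLpNorm (fun x ↦ ‖x‖ ^ t • u x) 2 μ := by
  refine ⟨√(∫ x in ball (0 : E) 1, ‖x‖ ^ (2 * -t) ∂μ) + 1, by positivity, fun u hu R hR ↦ ?_⟩
  have hcancel : ∀ᵐ x ∂μ.restrict (ball 0 R), ‖x‖ ^ (-t) • ‖x‖ ^ t • u x = u x := by
    filter_upwards [ae_restrict_of_ae (Measure.ae_ne μ (0 : E))] with x hx
    have hx' : 0 < ‖x‖ := norm_pos_iff.2 hx
    rw [smul_smul, ← Real.rpow_add hx', neg_add_cancel, Real.rpow_zero, one_smul]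
  calc ∫⁻ x in ball 0 R, ‖u x‖ₑ ∂μ
      = eLpNorm ((fun x : E ↦ ‖x‖ ^ (-t)) • fun x ↦ ‖x‖ ^ t • u x) 1 (μ.restrict (ball 0 R)) := by
        rw [← eLpNorm_one_eq_lintegral_enorm]
        exact (eLpNorm_congr_ae hcancel).symm
    _ ≤ eLpNorm (fun x : E ↦ ‖x‖ ^ (-t)) 2 (μ.restrict (ball 0 R)) *
          eLpNorm (fun x ↦ ‖x‖ ^ t • u x) 2 (μ.restrict (ball 0 R)) :=
        eLpNorm_smul_le_mul_eLpNorm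
          (((continuous_norm.measurable.pow_const t).aestronglyMeasurable.smul hu).restrict)
          (continuous_norm.measurable.pow_const (-t)).aestronglyMeasurable
    _ ≤ ENNReal.ofReal ((√(∫ x in ball (0 : E) 1, ‖x‖ ^ (2 * -t) ∂μ) + 1) *
          R ^ (finrank ℝ E / 2 - t)) * eLpNorm (fun x ↦ ‖x‖ ^ t • u x) 2 μ := by
        rw [eLpNorm_norm_rpow_restrict_ball μ (by linarith) hR, ← sub_eq_add_neg]
        gcongr
        · linarith
        · exact Measure.restrict_le_self

end Ball

theorem meas_lt_norm_add_le {α F : Type*} [MeasurableSpace α] {μ : Measure α}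
    [NormedAddCommGroup F] {g h : α → F} (hh : AEStronglyMeasurable h μ) {l : ℝ} (hl : 0 < l)
    (hg : ∀ᵐ x ∂μ, ‖g x‖ ≤ l / 2) :
    μ {x | l < ‖g x + h x‖} ≤ 4 * ENNReal.ofReal (l ^ (-2 : ℝ)) * eLpNorm h 2 μ ^ (2 : ℝ) := by
  have hl2 : (ENNReal.ofReal (l / 2))⁻¹ ^ (2 : ℝ) = 4 * ENNReal.ofReal (l ^ (-2 : ℝ)) := by
    rw [← ENNReal.ofReal_inv_of_pos (by positivity), ENNReal.ofReal_rpow_of_pos (by positivity),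
      ← ENNReal.ofReal_ofNat 4, ← ENNReal.ofReal_mul (by positivity), Real.rpow_neg hl.le,
      Real.rpow_two, Real.rpow_two]
    congr 1
    field_simp
    norm_num
  calc μ {x | l < ‖g x + h x‖}
      ≤ μ {x | ENNReal.ofReal (l / 2) ≤ ‖h x‖ₑ} := by
        refine measure_mono_ae ?_
        filter_upwards [hg] with x hgx (hx : l < ‖g x + h x‖)
        change ENNReal.ofReal (l / 2) ≤ ‖h x‖ₑ
        rw [← ofReal_norm]
        exact ENNReal.ofReal_le_ofReal (by linarith [norm_add_le (g x) (h x)])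
    _ ≤ (ENNReal.ofReal (l / 2))⁻¹ ^ (2 : ℝ) * eLpNorm h 2 μ ^ (2 : ℝ) :=
        meas_ge_le_mul_pow_eLpNorm_enorm _ two_ne_zero ENNReal.ofNat_ne_top hh
          (by simpa using hl) (by simp)
    _ = 4 * ENNReal.ofReal (l ^ (-2 : ℝ)) * eLpNorm h 2 μ ^ (2 : ℝ) := by rw [hl2]

section Fourier

variable {E F : Type*} [NormedAddCommGroup E] [InnerProductSpace ℝ E] [FiniteDimensional ℝ E]
  [MeasurableSpace E] [BorelSpace E] [NormedAddCommGroup F] [InnerProductSpace ℂ F]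

local notation "L²" => Lp F 2 (volume : Measure E)

theorem continuous_fourierInv {u : E → F} (hu : Integrable u) : Continuous (𝓕⁻ u) := by
  rw [Real.fourierInv_eq_fourier_comp_neg]
  exact VectorFourier.fourierIntegral_continuous Real.continuous_fourierChar
    (innerSL ℝ).continuous₂ hu.comp_neg

theorem enorm_fourierInv_le_lintegral (u : E → F) (x : E) : ‖𝓕⁻ u x‖ₑ ≤ ∫⁻ ξ, ‖u ξ‖ₑ := by
  rw [Real.fourierInv_eq]
  refine (enorm_integral_le_lintegral_enorm _).trans_eq (lintegral_congr fun ξ ↦ ?_)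
  rw [← ofReal_norm, ← ofReal_norm, Circle.norm_smul]

variable [CompleteSpace F]

theorem integral_fourierInv_smul_eq {φ : E → ℂ} {u : E → F} (hφ : Integrable φ)
    (hu : Integrable u) : ∫ ξ, 𝓕⁻ φ ξ • u ξ = ∫ x, φ x • 𝓕⁻ u x := by
  have hcont : Continuous fun p : E × E ↦ (-innerₗ E) p.1 p.2 := by
    simp only [LinearMap.neg_apply, innerₗ_apply_apply]
    fun_prop
  have hflip : (-innerₗ E).flip = -innerₗ E := by
    ext x y
    simp [real_inner_comm]
  have := VectorFourier.integral_fourierIntegral_smul_eq_flip (μ := volume) (ν := volume)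
    Real.continuous_fourierChar hcont hφ hu
  rwa [hflip] at this

theorem fourierInv_Lp_ae_eq (h : L²) (hint : Integrable h) :
    (𝓕⁻ h : L²) =ᵐ[volume] 𝓕⁻ (h : E → F) := by
  refine ae_eq_of_integral_contDiff_smul_eq ((Lp.memLp (𝓕⁻ h : L²)).locallyIntegrable one_le_two)
    (continuous_fourierInv hint).locallyIntegrable fun g hg hgc ↦ ?_
  have hg₁ : HasCompactSupport (Complex.ofRealCLM ∘ g) := hgc.comp_left rfl
  have hg₂ : ContDiff ℝ (⊤ : ℕ∞) (Complex.ofRealCLM ∘ g) := by fun_prop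
  set φ : 𝓢(E, ℂ) := hg₁.toSchwartzMap hg₂ with hφ
  have hdual : ((𝓕⁻ h : L²) : 𝓢'(E, F)) φ = (h : 𝓢'(E, F)) (𝓕⁻ φ) := by
    rw [← Lp.fourierInv_toTemperedDistribution_eq, TemperedDistribution.fourierInv_apply]
  rw [Lp.toTemperedDistribution_apply, Lp.toTemperedDistribution_apply, SchwartzMap.fourierInv_coe,
    integral_fourierInv_smul_eq φ.integrable hint] at hdual
  simpa [hφ] using hdual

theorem ae_enorm_le_lintegral_enorm_fourier (f : L²) :
    ∀ᵐ x, ‖f x‖ₑ ≤ ∫⁻ ξ, ‖(𝓕 f : L²) ξ‖ₑ := by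
  by_cases hfin : ∫⁻ ξ, ‖(𝓕 f : L²) ξ‖ₑ = ∞
  · simp [hfin]
  have hint : Integrable (𝓕 f : L²) := ⟨Lp.aestronglyMeasurable _, lt_top_iff_ne_top.2 hfin⟩
  have hinv := fourierInv_Lp_ae_eq (𝓕 f) hint
  rw [fourierInv_fourier_eq] at hinv
  filter_upwards [hinv] with x hx
  exact hx ▸ enorm_fourierInv_le_lintegral _ x

theorem eLpNorm_fourier_eq (f : L²) : eLpNorm (𝓕 f : L²) 2 volume = eLpNorm f 2 volume := by
  rw [← Lp.enorm_def, ← Lp.enorm_def, ← ofReal_norm, Lp.norm_fourier_eq, ofReal_norm]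

theorem exists_add_eq_fourier_indicator (f : L²) {S : Set E} (hS : MeasurableSet S) :
    ∃ g h : L², g + h = f ∧
      (𝓕 g : L²) =ᵐ[volume] S.indicator (𝓕 f : L²) ∧
      (𝓕 h : L²) =ᵐ[volume] Sᶜ.indicator (𝓕 f : L²) := by
  have hm := Lp.memLp (𝓕 f : L²)
  refine ⟨𝓕⁻ ((hm.indicator hS).toLp _), 𝓕⁻ ((hm.indicator hS.compl).toLp _), ?_, ?_, ?_⟩
  · rw [← FourierTransform.fourierInv_add, ← MemLp.toLp_add]
    simp only [indicator_self_add_compl, Lp.toLp_coeFn, fourierInv_fourier_eq]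
  · rw [fourier_fourierInv_eq]
    exact MemLp.coeFn_toLp _
  · rw [fourier_fourierInv_eq]
    exact MemLp.coeFn_toLp _

theorem meas_lt_norm_le_of_lintegral_fourier_le (f : L²) {S : Set E} (hS : MeasurableSet S)
    {l : ℝ} (hl : 0 < l) (hfS : ∫⁻ ξ in S, ‖(𝓕 f : L²) ξ‖ₑ ≤ ENNReal.ofReal (l / 2)) :
    volume {x | l < ‖f x‖} ≤
      4 * ENNReal.ofReal (l ^ (-2 : ℝ)) * ∫⁻ ξ in Sᶜ, ‖(𝓕 f : L²) ξ‖ₑ ^ (2 : ℝ) := by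
  obtain ⟨g, h, rfl, hg, hh⟩ := exists_add_eq_fourier_indicator f hS
  have hlow : ∀ᵐ x, ‖g x‖ ≤ l / 2 := by
    filter_upwards [ae_enorm_le_lintegral_enorm_fourier g] with x hx
    rw [← ENNReal.ofReal_le_ofReal_iff (by positivity), ofReal_norm]
    refine hx.trans (le_trans (le_of_eq ?_) hfS)
    rw [← eLpNorm_one_eq_lintegral_enorm, ← eLpNorm_one_eq_lintegral_enorm, eLpNorm_congr_ae hg,
      eLpNorm_indicator_eq_eLpNorm_restrict hS]
  have hhigh : eLpNorm h 2 volume ^ (2 : ℝ) = ∫⁻ ξ in Sᶜ, ‖(𝓕 (g + h) : L²) ξ‖ₑ ^ (2 : ℝ) := by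
    rw [← eLpNorm_fourier_eq, eLpNorm_congr_ae hh, eLpNorm_indicator_eq_eLpNorm_restrict hS.compl]
    exact eLpNorm_nnreal_pow_eq_lintegral two_ne_zero
  rw [← hhigh]
  refine (measure_congr ?_).trans_le
    (meas_lt_norm_add_le (Lp.aestronglyMeasurable h) hl hlow)
  filter_upwards [Lp.coeFn_add g h] with x hx
  exact congrArg (l < ‖·‖) hx

/-- The homogeneous Sobolev seminorm `‖|ξ|^t 𝓕 f‖_{L²}` of order `t`. -/
noncomputable def homSobolevSeminorm (t : ℝ) (f : L²) : ℝ≥0∞ :=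
  eLpNorm (fun ξ ↦ ‖ξ‖ ^ t • (𝓕 f : L²) ξ) 2 volume

theorem homSobolevSeminorm_zero (f : L²) :
    homSobolevSeminorm 0 f = eLpNorm f 2 volume := by
  simp only [homSobolevSeminorm, Real.rpow_zero, one_smul, eLpNorm_fourier_eq]

theorem lintegral_norm_rpow_withDensity_fourier (t : ℝ) (f : L²) :
    ∫⁻ ξ, ENNReal.ofReal (‖ξ‖ ^ (2 * t)) ∂volume.withDensity (fun ξ ↦ ‖(𝓕 f : L²) ξ‖ₑ ^ (2 : ℝ)) =
      homSobolevSeminorm t f ^ (2 : ℝ) := by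
  rw [lintegral_withDensity_eq_lintegral_mul₀
    ((Lp.aestronglyMeasurable (𝓕 f : L²)).enorm.pow_const _) (by fun_prop), homSobolevSeminorm]
  refine .trans ?_ (eLpNorm_nnreal_pow_eq_lintegral two_ne_zero).symm
  refine lintegral_congr fun ξ ↦ ?_
  rw [enorm_smul, NNReal.coe_ofNat, ENNReal.mul_rpow_of_nonneg _ _ two_pos.le,
    Real.enorm_of_nonneg (by positivity), ENNReal.ofReal_rpow_of_nonneg (by positivity) two_pos.le,
    ← Real.rpow_mul (norm_nonneg ξ), mul_comm t, mul_comm]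
  rfl

variable [Nontrivial E]

theorem meas_lt_norm_le_withDensity_fourier {t : ℝ} (ht : 2 * t < finrank ℝ E) :
    ∃ K > 0, ∀ (f : L²), ∀ M > 0, homSobolevSeminorm t f ≤ ENNReal.ofReal M → ∀ l > 0,
      volume {x | l < ‖f x‖} ≤ 4 * ENNReal.ofReal (l ^ (-2 : ℝ)) *
        volume.withDensity (fun ξ ↦ ‖(𝓕 f : L²) ξ‖ₑ ^ (2 : ℝ))
          {ξ | l ≤ K * M * ‖ξ‖ ^ (finrank ℝ E / 2 - t)} := by
  obtain ⟨K, hK, hball⟩ := lintegral_ball_enorm_le (F := F) (volume : Measure E) ht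
  refine ⟨2 * K, by positivity, fun f M hM hf l hl ↦ ?_⟩
  have ha : 0 < finrank ℝ E / 2 - t := by linarith
  set a : ℝ := finrank ℝ E / 2 - t
  set R : ℝ := (l / (2 * K * M)) ^ a⁻¹
  have hR : 0 < R := by positivity
  have hRa : R ^ a = l / (2 * K * M) := Real.rpow_inv_rpow (by positivity) ha.ne'
  have hlow : ∫⁻ ξ in ball 0 R, ‖(𝓕 f : L²) ξ‖ₑ ≤ ENNReal.ofReal (l / 2) :=
    calc ∫⁻ ξ in ball 0 R, ‖(𝓕 f : L²) ξ‖ₑ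
        ≤ ENNReal.ofReal (K * R ^ a) * homSobolevSeminorm t f :=
          hball _ (Lp.aestronglyMeasurable _) R hR
      _ ≤ ENNReal.ofReal (K * R ^ a) * ENNReal.ofReal M := by gcongr
      _ = ENNReal.ofReal (l / 2) := by
          rw [← ENNReal.ofReal_mul (by positivity), hRa]
          congr 1
          field_simp
  have hset : (ball 0 R)ᶜ = {ξ : E | l ≤ 2 * K * M * ‖ξ‖ ^ a} := by
    ext ξ
    rw [mem_compl_iff, mem_ball_zero_iff, not_lt, mem_ofPred_eq, ← div_le_iff₀' (by positivity),
      ← hRa, Real.rpow_le_rpow_iff hR.le (norm_nonneg ξ) ha]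
  rw [← hset, withDensity_apply _ measurableSet_ball.compl]
  exact meas_lt_norm_le_of_lintegral_fourier_le f measurableSet_ball hl hlow

theorem lintegral_norm_rpow_le_of_homSobolevSeminorm_le {t q : ℝ} (ht : 2 * t < finrank ℝ E)
    (hq : 2 < q) (htq : (finrank ℝ E / 2 - t) * (q - 2) = 2 * t) :
    ∃ C : ℝ, 0 < C ∧ ∀ (f : L²), ∀ M > 0, homSobolevSeminorm t f ≤ ENNReal.ofReal M →
      ∫⁻ x, ENNReal.ofReal (‖f x‖ ^ q) ≤ ENNReal.ofReal (C * M ^ q) := by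
  obtain ⟨K, hK, hweak⟩ := meas_lt_norm_le_withDensity_fourier (F := F) ht
  have : 0 < q - 2 := sub_pos.2 hq
  refine ⟨4 * (q / (q - 2)) * K ^ (q - 2), by positivity, fun f M hM hf ↦ ?_⟩
  set ν := volume.withDensity fun ξ ↦ ‖(𝓕 f : L²) ξ‖ₑ ^ (2 : ℝ)
  have hpow (ξ : E) : (K * M * ‖ξ‖ ^ (finrank ℝ E / 2 - t)) ^ (q - 2) =
      (K * M) ^ (q - 2) * ‖ξ‖ ^ (2 * t) := by
    rw [Real.mul_rpow (by positivity) (by positivity), ← Real.rpow_mul (norm_nonneg ξ), htq]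
  calc ∫⁻ x, ENNReal.ofReal (‖f x‖ ^ q)
      ≤ 4 * ENNReal.ofReal (q / (q - 2)) *
          ∫⁻ ξ, ENNReal.ofReal ((K * M * ‖ξ‖ ^ (finrank ℝ E / 2 - t)) ^ (q - 2)) ∂ν :=
        lintegral_rpow_le_of_meas_lt_le (C := 4) (fun x ↦ norm_nonneg (f x))
          (Lp.aestronglyMeasurable f).norm.aemeasurable (fun ξ ↦ by positivity)
          (by fun_prop) (by positivity) hq (hweak f M hM hf)
    _ = 4 * ENNReal.ofReal (q / (q - 2)) *
          (ENNReal.ofReal ((K * M) ^ (q - 2)) * homSobolevSeminorm t f ^ (2 : ℝ)) := by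
        simp_rw [hpow, ENNReal.ofReal_mul (Real.rpow_nonneg (mul_pos hK hM).le _)]
        rw [lintegral_const_mul' _ _ ENNReal.ofReal_ne_top, lintegral_norm_rpow_withDensity_fourier]
    _ ≤ 4 * ENNReal.ofReal (q / (q - 2)) *
          (ENNReal.ofReal ((K * M) ^ (q - 2)) * ENNReal.ofReal M ^ (2 : ℝ)) := by gcongr
    _ = ENNReal.ofReal (4 * (q / (q - 2)) * K ^ (q - 2) * M ^ q) := by
        rw [ENNReal.ofReal_rpow_of_pos hM, ← ENNReal.ofReal_ofNat 4,
          ← ENNReal.ofReal_mul (by positivity), ← ENNReal.ofReal_mul (by positivity),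
          ← ENNReal.ofReal_mul (by positivity), Real.mul_rpow hK.le hM.le, mul_assoc (K ^ _),
          ← Real.rpow_add hM, sub_add_cancel, mul_assoc _ (K ^ _)]

theorem eLpNorm_le_mul_homSobolevSeminorm {q : ℝ≥0} (hq : 2 < q) :
    ∃ C : ℝ≥0, ∀ f : L²,
      eLpNorm f q volume ≤ C * homSobolevSeminorm (finrank ℝ E * (2⁻¹ - (q : ℝ)⁻¹)) f := by
  have hq2 : (2 : ℝ) < q := mod_cast hq
  have hq0 : (0 : ℝ) < q := two_pos.trans hq2
  have hd : 0 < finrank ℝ E / (q : ℝ) := div_pos (mod_cast finrank_pos) hq0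
  obtain ⟨C, hC, hCf⟩ := lintegral_norm_rpow_le_of_homSobolevSeminorm_le (E := E) (F := F)
    (t := finrank ℝ E * (2⁻¹ - (q : ℝ)⁻¹)) (by linear_combination 2 * hd) hq2
    (by field_simp; ring)
  lift C to ℝ≥0 using hC.le
  refine ⟨C ^ (q : ℝ)⁻¹, fun f ↦ ?_⟩
  have hC0 : 0 < C ^ (q : ℝ)⁻¹ := NNReal.rpow_pos hC
  -- The bound `M` on the seminorm has to be positive, while the seminorm itself may vanish.
  refine ENNReal.le_mul_of_forall_lt (.inl (mod_cast hC0.ne')) (.inl ENNReal.coe_ne_top)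
    fun a ha M hM ↦ le_trans ?_ (mul_le_mul_left ha.le M)
  rcases eq_or_ne M ∞ with rfl | hMtop
  · simp [hC0.ne']
  lift M to ℝ≥0 using hMtop
  have hM0 : 0 < M := ENNReal.coe_pos.1 (pos_of_gt hM)
  rw [← ENNReal.rpow_le_rpow_iff hq0]
  calc eLpNorm f q volume ^ (q : ℝ) = ∫⁻ x, ENNReal.ofReal (‖f x‖ ^ (q : ℝ)) := by
        rw [eLpNorm_nnreal_pow_eq_lintegral (mod_cast hq0.ne')]
        exact lintegral_congr fun x ↦ by
          rw [← ENNReal.ofReal_rpow_of_nonneg (norm_nonneg _) hq0.le, ofReal_norm]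
    _ ≤ ENNReal.ofReal (C * (M : ℝ) ^ (q : ℝ)) := hCf f M hM0 (by simpa using hM.le)
    _ = (↑(C ^ (q : ℝ)⁻¹) * M) ^ (q : ℝ) := by
        rw [← NNReal.coe_rpow, ← NNReal.coe_mul, ENNReal.ofReal_coe_nnreal, ← ENNReal.coe_mul,
          ← ENNReal.coe_rpow_of_nonneg _ hq0.le, NNReal.mul_rpow, NNReal.rpow_inv_rpow hq0.ne']

end Fourier

section Embedding

variable {n : ℕ} {s : ℝ}

theorem HasBessel.fourier_ae_eq (hs : 0 ≤ s) {F G : Lp ℂ 2 (volume : Measure (Euc n))}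
    (h : HasBessel s F G) :
    ∀ᵐ ξ, (𝓕 F : Lp ℂ 2 (volume : Measure (Euc n))) ξ =
      (((1 + ‖ξ‖ ^ 2) ^ (-s / 2) : ℝ) : ℂ) * (𝓕 G : Lp ℂ 2 (volume : Measure (Euc n))) ξ := by
  set m : Euc n → ℂ := fun ξ ↦ (((1 + ‖ξ‖ ^ 2) ^ (-s / 2) : ℝ) : ℂ)
  have hmt : m.HasTemperateGrowth := by fun_prop
  have hmb : MemLp m ∞ := by
    refine memLp_top_of_bound hmt.1.continuous.aestronglyMeasurable 1 (.of_forall fun ξ ↦ ?_)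
    rw [Complex.norm_of_nonneg (by positivity)]
    exact Real.rpow_le_one_of_one_le_of_nonpos (by simp) (by linarith)
  have hmul : hmb.toLp • 𝓕 G = 𝓕 F := by
    have hFG := (TemperedDistribution.besselPotential_neg_apply_eq_iff s
      (G : 𝓢'(Euc n, ℂ)) (F : 𝓢'(Euc n, ℂ))).2 h
    apply_fun 𝓕 at hFG
    rw [TemperedDistribution.fourier_besselPotential_eq_smulLeftCLM_fourier_apply,
      Lp.fourier_toTemperedDistribution_eq, Lp.fourier_toTemperedDistribution_eq,
      ← Lp.toTemperedDistribution_smul_eq (r := 2) hmt hmb] at hFG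
    exact LinearMap.ker_eq_bot.1 (Lp.ker_toTemperedDistributionCLM_eq_bot (F := ℂ)
      (μ := (volume : Measure (Euc n))) (p := 2)) hFG
  rw [← hmul]
  filter_upwards [Lp.coeFn_lpSMul (r := 2) hmb.toLp (𝓕 G), hmb.coeFn_toLp] with ξ hsmul hm
  rw [hsmul, Pi.smul_apply', hm, smul_eq_mul]

theorem norm_rpow_mul_le_one {E : Type*} [SeminormedAddCommGroup E] (x : E) {t : ℝ} (ht : 0 ≤ t)
    (hts : t ≤ s) : ‖x‖ ^ t * (1 + ‖x‖ ^ 2) ^ (-s / 2) ≤ 1 := by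
  rw [neg_div, Real.rpow_neg (by positivity), ← div_eq_mul_inv]
  refine div_le_one_of_le₀ ?_ (by positivity)
  calc ‖x‖ ^ t = (‖x‖ ^ 2) ^ (t / 2) := by
        rw [← Real.rpow_two, ← Real.rpow_mul (norm_nonneg x), mul_div_cancel₀ t two_ne_zero]
    _ ≤ (1 + ‖x‖ ^ 2) ^ (t / 2) := by gcongr; simp
    _ ≤ (1 + ‖x‖ ^ 2) ^ (s / 2) := by gcongr; simp

theorem HasBessel.homSobolevSeminorm_le {t : ℝ} (ht : 0 ≤ t) (hts : t ≤ s)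
    {F G : Lp ℂ 2 (volume : Measure (Euc n))} (h : HasBessel s F G) :
    homSobolevSeminorm t F ≤ ‖G‖ₑ := by
  rw [Lp.enorm_def, ← eLpNorm_fourier_eq]
  refine eLpNorm_mono_ae ?_
  filter_upwards [h.fourier_ae_eq (ht.trans hts)] with ξ hξ
  rw [hξ, norm_smul, norm_mul, Complex.norm_of_nonneg (by positivity),
    Real.norm_of_nonneg (by positivity), ← mul_assoc]
  exact mul_le_of_le_one_left (norm_nonneg _) (norm_rpow_mul_le_one ξ ht hts)

theorem exists_eLpNorm_le_of_hasBessel [NeZero n] {q : ℝ≥0} (hq : 2 ≤ q)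
    (hs : n * (2⁻¹ - (q : ℝ)⁻¹) ≤ s) :
    ∃ C : ℝ≥0, ∀ F G : Lp ℂ 2 (volume : Measure (Euc n)), HasBessel s F G →
      eLpNorm F q volume ≤ C * ‖G‖ₑ := by
  rcases hq.eq_or_lt with rfl | hq
  · refine ⟨1, fun F G h ↦ ?_⟩
    rw [ENNReal.coe_one, one_mul, ENNReal.coe_ofNat, ← homSobolevSeminorm_zero]
    exact h.homSobolevSeminorm_le le_rfl (by simpa using hs)
  · obtain ⟨C, hC⟩ := eLpNorm_le_mul_homSobolevSeminorm (E := Euc n) (F := ℂ) hq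
    refine ⟨C, fun F G h ↦ (hC F).trans ?_⟩
    rw [finrank_euclideanSpace_fin]
    gcongr
    have : (q : ℝ)⁻¹ ≤ 2⁻¹ := by gcongr; exact_mod_cast hq.le
    exact h.homSobolevSeminorm_le (mul_nonneg n.cast_nonneg (sub_nonneg.2 this)) hs

end Embedding

section Multiplication

variable {α : Type*} [MeasurableSpace α] {μ : Measure α} {p q r : ℝ≥0∞}

theorem exists_memLp_top_eLpNorm_sub_le {E : Type*} [NormedAddCommGroup E] {W : α → E}
    (hW : MemLp W p μ) {δ : ℝ≥0∞} (hδ : δ ≠ 0) :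
    ∃ S : α → E, MemLp S ∞ μ ∧ eLpNorm (W - S) p μ ≤ δ := by
  rcases eq_or_ne p ∞ with rfl | hp
  · exact ⟨W, hW, by simp⟩
  · obtain ⟨S, hS, -⟩ := hW.exists_simpleFunc_eLpNorm_sub_lt hp hδ
    exact ⟨S, S.memLp_top μ, hS.le⟩

theorem exists_eLpNorm_mul_le {𝕜 : Type*} [NormedField 𝕜] {W : α → 𝕜} [p.HolderTriple q r]
    (hr : 1 ≤ r) (hW : MemLp W p μ) {δ : ℝ≥0∞} (hδ : δ ≠ 0) :
    ∃ C : ℝ≥0, ∀ f : α → 𝕜, AEStronglyMeasurable f μ →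
      eLpNorm (W * f) r μ ≤ δ * eLpNorm f q μ + C * eLpNorm f r μ := by
  obtain ⟨S, hS, hWS⟩ := exists_memLp_top_eLpNorm_sub_le hW hδ
  refine ⟨(eLpNorm S ∞ μ).toNNReal, fun f hf ↦ ?_⟩
  rw [ENNReal.coe_toNNReal hS.eLpNorm_ne_top]
  have hWSm : AEStronglyMeasurable (W - S) μ := hW.1.sub hS.1
  calc eLpNorm (W * f) r μ = eLpNorm ((W - S) • f + S • f) r μ := by
        rw [← add_smul, sub_add_cancel, smul_eq_mul]
    _ ≤ eLpNorm ((W - S) • f) r μ + eLpNorm (S • f) r μ :=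
        eLpNorm_add_le (hWSm.smul hf) (hS.1.smul hf) hr
    _ ≤ eLpNorm (W - S) p μ * eLpNorm f q μ + eLpNorm S ∞ μ * eLpNorm f r μ :=
        add_le_add (eLpNorm_smul_le_mul_eLpNorm hf hWSm) (eLpNorm_smul_le_mul_eLpNorm hf hS.1)
    _ ≤ δ * eLpNorm f q μ + eLpNorm S ∞ μ * eLpNorm f r μ := by gcongr

end Multiplication

section MulBound

variable {n : ℕ} {s : ℝ} {Ω : Opens (Euc n)} {p : ℝ≥0∞} {W : Euc n → ℂ}

theorem exists_holderTriple_two (hp : 2 < p) :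
    ∃ q : ℝ≥0, 2 ≤ q ∧ p.HolderTriple q 2 ∧ 2⁻¹ - (q : ℝ)⁻¹ = p⁻¹.toReal := by
  have hp' : p⁻¹ < 2⁻¹ := ENNReal.inv_lt_inv.2 hp
  have hq : 2⁻¹ - p⁻¹ ≠ 0 := (tsub_pos_of_lt hp').ne'
  lift (2⁻¹ - p⁻¹)⁻¹ to ℝ≥0 using ENNReal.inv_ne_top.2 hq with q hq'
  have hqinv : (q : ℝ≥0∞)⁻¹ = 2⁻¹ - p⁻¹ := by rw [hq', inv_inv]
  refine ⟨q, ?_, ⟨by rw [hqinv, add_tsub_cancel_of_le hp'.le]⟩, ?_⟩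
  · rw [← ENNReal.coe_le_coe, ENNReal.coe_ofNat, ← ENNReal.inv_le_inv, hqinv]
    exact tsub_le_self
  · have := congrArg ENNReal.toReal hqinv
    rw [ENNReal.toReal_sub_of_le hp'.le (by simp), ENNReal.toReal_inv, ENNReal.toReal_inv,
      ENNReal.coe_toReal, ENNReal.toReal_ofNat] at this
    rw [this, ENNReal.toReal_inv, sub_sub_cancel]

theorem exists_eLpNorm_mul_le_of_hasBessel [NeZero n] (hp : 2 < p) (hps : n * p⁻¹.toReal ≤ s)
    (hW : MemLp W p (volume.restrict (Ω : Set (Euc n)))) {ε : ℝ≥0∞} (hε : ε ≠ 0) :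
    ∃ C : ℝ≥0, ∀ (f : L2 Ω) (F G : Lp ℂ 2 (volume : Measure (Euc n))),
      HasBessel s F G → Restricts F f →
      eLpNorm (fun x ↦ W x * f x) 2 (volume.restrict (Ω : Set (Euc n))) ≤
        ε * ‖G‖ₑ + C * ‖f‖ₑ := by
  obtain ⟨q, hq, _, hpq⟩ := exists_holderTriple_two hp
  obtain ⟨K, hK⟩ := exists_eLpNorm_le_of_hasBessel hq (hpq ▸ hps)
  obtain ⟨C, hC⟩ := exists_eLpNorm_mul_le (q := q) one_le_two hW
    (ENNReal.div_ne_zero.2 ⟨hε, ENNReal.coe_ne_top (r := K)⟩)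
  refine ⟨C, fun f F G hFG hFf ↦ (hC f (Lp.aestronglyMeasurable f)).trans ?_⟩
  rw [← Lp.enorm_def]
  gcongr ?_ + _
  calc ε / K * eLpNorm f q (volume.restrict (Ω : Set (Euc n)))
      ≤ ε / K * (K * ‖G‖ₑ) := by
        rw [← eLpNorm_congr_ae hFf]
        gcongr
        exact (eLpNorm_mono_measure _ Measure.restrict_le_self).trans (hK F G hFG)
    _ = K * (ε / K) * ‖G‖ₑ := by ring
    _ ≤ ε * ‖G‖ₑ := by
        gcongr
        exact ENNReal.mul_div_le

theorem le_hsNorm {f : L2 Ω} (hf : f ∈ Hs s Ω) {c : ℝ}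
    (h : ∀ F G, HasBessel s F G → Restricts F f → c ≤ ‖G‖) : c ≤ hsNorm s f := by
  obtain ⟨F, ⟨G, hFG⟩, hFf⟩ := hf
  refine le_csInf ⟨_, F, G, hFG, hFf, rfl⟩ ?_
  rintro _ ⟨F', G', hFG', hFf', rfl⟩
  exact h F' G' hFG' hFf'

theorem mulBound_of_memLp [NeZero n] (hp : 2 < p) (hps : n * p⁻¹.toReal ≤ s)
    (hW : MemLp W p (volume.restrict (Ω : Set (Euc n)))) : MulBound s Ω W := by
  have hconj (f : L2 Ω) (x : Euc n) : ‖W x * f x‖ = ‖conj (W x) * f x‖ := by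
    rw [norm_mul, norm_mul, RCLike.norm_conj]
  refine ⟨fun f hf ↦ ?_, fun ε hε ↦ ?_⟩
  · obtain ⟨F, ⟨G, hFG⟩, hFf⟩ := hf
    obtain ⟨C, hC⟩ := exists_eLpNorm_mul_le_of_hasBessel hp hps hW one_ne_zero
    have hmem : MemLp (fun x ↦ W x * f x) 2 (volume.restrict (Ω : Set (Euc n))) :=
      ⟨hW.1.mul (Lp.aestronglyMeasurable f), (hC f F G hFG hFf).trans_lt (by finiteness)⟩
    exact ⟨hmem, hmem.congr_norm ((Complex.continuous_conj.comp_aestronglyMeasurable hW.1).mul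
      (Lp.aestronglyMeasurable f)) (.of_forall (hconj f))⟩
  · obtain ⟨C, hC⟩ := exists_eLpNorm_mul_le_of_hasBessel hp hps hW (ENNReal.ofReal_pos.2 hε).ne'
    refine ⟨C + 1, by positivity, fun f hf ↦ ⟨?_, ?_⟩⟩
    · rw [eLpNorm_congr_norm_ae (.of_forall (hconj f))]
    have hreal (F G) (hFG : HasBessel s F G) (hFf : Restricts F f) :
        (eLpNorm (fun x ↦ W x * f x) 2 (volume.restrict (Ω : Set (Euc n)))).toReal ≤
          ε * ‖G‖ + C * ‖f‖ := by
      refine ENNReal.toReal_le_of_le_ofReal (by positivity) ((hC f F G hFG hFf).trans_eq ?_)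
      rw [ENNReal.ofReal_add (by positivity) (by positivity), ENNReal.ofReal_mul hε.le,
        ENNReal.ofReal_mul C.coe_nonneg, ofReal_norm, ofReal_norm, ENNReal.ofReal_coe_nnreal]
    have hinf := le_hsNorm hf fun F G hFG hFf ↦
      (div_le_iff₀' hε).2 (sub_le_iff_le_add.2 (hreal F G hFG hFf))
    rw [div_le_iff₀' hε] at hinf
    linarith [norm_nonneg f]

theorem two_lt_and_mul_inv_toReal_le [NeZero n] (hs : 0 < s)
    (h₁ : 2 * s < n → ENNReal.ofReal (n / s) ≤ p) (h₂ : n ≤ 2 * s → 2 < p) :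
    2 < p ∧ n * p⁻¹.toReal ≤ s := by
  have hn : (0 : ℝ) < n := Nat.cast_pos.2 (NeZero.pos n)
  rcases lt_or_ge (2 * s) n with hsn | hsn
  · have hp := h₁ hsn
    constructor
    · refine lt_of_lt_of_le ?_ hp
      rwa [← ENNReal.ofReal_ofNat 2, ENNReal.ofReal_lt_ofReal_iff (by positivity), lt_div_iff₀ hs]
    · rw [← le_div_iff₀' hn]
      refine ENNReal.toReal_le_of_le_ofReal (by positivity) ?_
      rwa [← inv_div, ENNReal.ofReal_inv_of_pos (by positivity), ENNReal.inv_le_inv]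
  · refine ⟨h₂ hsn, ?_⟩
    have hp : p⁻¹.toReal ≤ 2⁻¹ := ENNReal.toReal_le_of_le_ofReal (by norm_num) (by
      rw [ENNReal.ofReal_inv_of_pos two_pos, ENNReal.ofReal_ofNat, ENNReal.inv_le_inv]
      exact (h₂ hsn).le)
    linarith [mul_le_mul_of_nonneg_left hp hn.le]

end MulBound

section Distributions

variable {n : ℕ} {s : ℝ} {Ω : Opens (Euc n)} {u v : Euc n → ℂ}

theorem toDistr_apply (hu : MemLp u 2 (volume.restrict (Ω : Set (Euc n)))) (φ : 𝓓(Ω, ℝ)) :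
    toDistr Ω u φ = ∫ x in (Ω : Set (Euc n)), φ x • u x :=
  TestFunction.integralAgainstBilinCLM_eq_integral
    ((hu.locallyIntegrable one_le_two).locallyIntegrableOn _)

theorem toDistr_congr (hu : MemLp u 2 (volume.restrict (Ω : Set (Euc n))))
    (huv : u =ᵐ[volume.restrict (Ω : Set (Euc n))] v) : toDistr Ω u = toDistr Ω v := by
  ext φ
  rw [toDistr_apply hu, toDistr_apply (hu.ae_eq huv)]
  exact integral_congr_ae (huv.mono fun x hx ↦ by simp only [hx])

theorem toDistr_add (hu : MemLp u 2 (volume.restrict (Ω : Set (Euc n))))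
    (hv : MemLp v 2 (volume.restrict (Ω : Set (Euc n)))) :
    toDistr Ω (u + v) = toDistr Ω u + toDistr Ω v := by
  ext φ
  rw [add_apply, toDistr_apply (hu.add hv), toDistr_apply hu, toDistr_apply hv, ← integral_add]
  · simp only [Pi.add_apply, smul_add]
  all_goals
    exact (MemLp.locallyIntegrable ‹_› one_le_two).integrable_smul_left_of_hasCompactSupport
      φ.continuous φ.hasCompactSupport

/-- The subgroup of distributions on `Ω` that belong to `L²(Ω)`; see `mem_l2Distr`. -/
noncomputable def l2Distr (Ω : Opens (Euc n)) : AddSubgroup 𝓓'(Ω, ℂ) :=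
  (AddMonoidHom.mk' (fun f : L2 Ω ↦ toDistr Ω f) fun f g ↦ by
    rw [toDistr_congr (Lp.memLp _) (Lp.coeFn_add f g),
      toDistr_add (Lp.memLp f) (Lp.memLp g)]).range

theorem mem_l2Distr {T : 𝓓'(Ω, ℂ)} : T ∈ l2Distr Ω ↔ InL2 T :=
  exists_congr fun _ ↦ eq_comm

theorem inL2_toDistr (hu : MemLp u 2 (volume.restrict (Ω : Set (Euc n)))) :
    InL2 (toDistr Ω u) :=
  ⟨hu.toLp, toDistr_congr hu hu.coeFn_toLp.symm⟩

theorem hsLaplace_eq_hsSchrodinger {V : Euc n → ℂ}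
    (hV : ∀ f ∈ Hs s Ω, MemLp (fun x ↦ V x * f x) 2 (volume.restrict (Ω : Set (Euc n)))) :
    HsLaplace s Ω = HsSchrodinger s Ω V := by
  ext f
  refine and_congr_right fun hf ↦ ?_
  rw [← mem_l2Distr, ← mem_l2Distr,
    AddSubgroup.add_mem_cancel_right _ (mem_l2Distr.2 (inL2_toDistr (hV f hf))), neg_mem_iff]

end Distributions

end SobolevMult

theorem lemma3p2_general {n : ℕ} [NeZero n] (Ω : Opens (SobolevMult.Euc n)) {s : ℝ} {p : ℝ≥0∞}
    {W : SobolevMult.Euc n → ℂ} (hs : 0 < s) (h₁ : 2 * s < n → ENNReal.ofReal (n / s) ≤ p)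
    (h₂ : n ≤ 2 * s → 2 < p) (hW : MemLp W p (volume.restrict (Ω : Set (SobolevMult.Euc n)))) :
    SobolevMult.MulBound s Ω W ∧
      SobolevMult.HsLaplace s Ω = SobolevMult.HsSchrodinger s Ω W ∧
      SobolevMult.HsLaplace s Ω = SobolevMult.HsSchrodinger s Ω (fun x ↦ conj (W x)) := by
  obtain ⟨hp, hps⟩ := SobolevMult.two_lt_and_mul_inv_toReal_le hs h₁ h₂
  have hmul := SobolevMult.mulBound_of_memLp hp hps hW
  exact ⟨hmul, SobolevMult.hsLaplace_eq_hsSchrodinger fun f hf ↦ (hmul.1 f hf).1,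
    SobolevMult.hsLaplace_eq_hsSchrodinger fun f hf ↦ (hmul.1 f hf).2⟩

theorem lemma3p2 {n : ℕ} (hn : 2 ≤ n) (Ω : Opens (SobolevMult.Euc n))
    (hΩ : SobolevMult.IsBoundedLipschitz Ω ∨ SobolevMult.IsExteriorLipschitz Ω) :
    (∀ (s : ℝ) (p : ℝ≥0∞) (W : SobolevMult.Euc n → ℂ), 0 < s →
      (2 * s < (n : ℝ) → ENNReal.ofReal ((n : ℝ) / s) ≤ p) →
      ((n : ℝ) ≤ 2 * s → 2 < p) →
      MemLp W p (volume.restrict (Ω : Set (SobolevMult.Euc n))) →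
      SobolevMult.MulBound s Ω W) ∧
    (∀ (p : ℝ≥0∞) (V : SobolevMult.Euc n → ℂ),
      (3 < n → ENNReal.ofReal (2 * (n : ℝ) / 3) ≤ p) →
      (n ≤ 3 → 2 < p) →
      MemLp V p (volume.restrict (Ω : Set (SobolevMult.Euc n))) →
      SobolevMult.MulBound (3 / 2) Ω V ∧
      SobolevMult.HsLaplace (3 / 2) Ω = SobolevMult.HsSchrodinger (3 / 2) Ω V ∧
      SobolevMult.HsLaplace (3 / 2) Ω =
        SobolevMult.HsSchrodinger (3 / 2) Ω (fun x ↦ conj (V x))) := by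
  have : NeZero n := ⟨by lia⟩
  refine ⟨fun s p W hs h₁ h₂ hW ↦ (lemma3p2_general Ω hs h₁ h₂ hW).1, fun p V h₁ h₂ hV ↦ ?_⟩
  refine lemma3p2_general Ω (by norm_num) ?_ ?_ hV <;>
    rw [mul_div_cancel₀ (3 : ℝ) two_ne_zero]
  · rw [div_div_eq_mul_div, mul_comm]
    exact_mod_cast h₁
  · exact_mod_cast h₂
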